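/- Let $N\ge 1$ be an integer and $1<p<\infty$. All operators below are bounded linear operators on the complex space $l^p(\mathbb Z^N)$; $sp(A)$ is the spectrum of $A$ and $sp_{ess}(A)$ is the set of all $\lambda\in\mathbb C$ for which $A-\lambda I$ is not Fredholm, where an operator is Fredholm if its kernel and its cokernel are finite dimensional. For $g\in\mathbb Z^N$ let $(V_g u)(x)=u(x-g)$. Let $W(\mathbb Z^N)$ be the set of all operators $A=\sum_{\alpha\in\mathbb Z^N}a_\alpha V_\alpha$ with $a_\alpha\in l^\infty(\mathbb Z^N)$ and $\sum_\alpha\|a_\alpha\|_\infty<\infty$. A function $a\in l^\infty(\mathbb Z^N)$ is almost-periodic if every sequence $h:\mathbb N\to\mathbb Z^N$ tending to infinity has a subsequence $g$ such that $V_{-g(j)}a$ converges in the norm of $l^\infty(\mathbb Z^N)$ as $j\to\infty$; let $W^{AP}(\mathbb Z^N)$ be the set of all $A\in W(\mathbb Z^N)$ all of whose coefficients $a_\alpha$ are almost-periodic. A bounded operator $A_h$ is a limit operator of $A$ if there is a sequence $h:\mathbb N\to\mathbb Z^N$ tending to infinity such that $V_{-h(j)}AV_{h(j)}\to A_h$ strongly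 on $l^p(\mathbb Z^N)$ and $(V_{-h(j)}AV_{h(j)})^*\to A_h^*$ strongly on the dual space of $l^p(\mathbb Z^N)$. (i) Let $A\in W(\mathbb Z^N)$, and assume that there exist a sequence $h:\mathbb N\to\mathbb Z^N$ tending to infinity and a bounded operator $A_h$ such that $\lim_{j\to\infty}\|V_{-h(j)}AV_{h(j)}-A_h\|=0$ in the operator norm. Then $sp_{ess}(A)=sp(A)$. (ii) Let $A\in W^{AP}(\mathbb Z^N)$. Then $sp(A)=sp_{ess}(A)$, and $sp(A)=sp(A_h)$ for every limit operator $A_h$ of $A$. -/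

import Mathlib

open Filter Topology
open scoped ENNReal lp

noncomputable section

namespace LimitOp

/-- The lattice `ℤ^N`. -/
abbrev Lattice (N : ℕ) : Type := Fin N → ℤ

/-- The Banach space `l^p(ℤ^N)` of complex-valued functions on the lattice. -/
abbrev Seq (N : ℕ) (p : ℝ≥0∞) : Type := ℓ^p(Lattice N, ℂ)

/-- The Banach algebra `L(l^p(ℤ^N))` of bounded linear operators, with the operator norm. -/
abbrev Op (N : ℕ) (p : ℝ≥0∞) [Fact (1 ≤ p)] : Type := Seq N p →L[ℂ] Seq N p

section Shift

variable {N : ℕ}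

theorem memℓp_shift {p : ℝ≥0∞} [hp : Fact (1 ≤ p)] (g : Lattice N) (u : Seq N p) :
    Memℓp (fun x : Lattice N => u (x - g)) p := by
  rcases eq_or_ne p ∞ with rfl | hp'
  · have hu := (lp.memℓp u).bddAbove
    refine memℓp_infty (hu.mono ?_)
    rintro _ ⟨x, rfl⟩
    exact ⟨x - g, rfl⟩
  · have h0 : 0 < p.toReal := ENNReal.toReal_pos (zero_lt_one.trans_le hp.out).ne' hp'
    exact memℓp_gen (((Equiv.subRight g).summable_iff).2 ((lp.memℓp u).summable h0))

theorem norm_shift_le {p : ℝ≥0∞} [hp : Fact (1 ≤ p)] (g : Lattice N) (u : Seq N p) :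
    ‖(⟨fun x : Lattice N => u (x - g), memℓp_shift g u⟩ : Seq N p)‖ ≤ ‖u‖ := by
  rcases eq_or_ne p ∞ with rfl | hp'
  · exact lp.norm_le_of_forall_le (norm_nonneg u)
      fun x => lp.norm_apply_le_norm (by simp) u (x - g)
  · have h0 : 0 < p.toReal := ENNReal.toReal_pos (zero_lt_one.trans_le hp.out).ne' hp'
    refine lp.norm_le_of_tsum_le h0 (norm_nonneg u) ?_
    rw [lp.norm_rpow_eq_tsum h0 u]
    exact ((Equiv.subRight g).tsum_eq (fun x => ‖u x‖ ^ p.toReal)).le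

/-- The shift operator `V_g`, `(V_g u)(x) = u(x - g)`, on `l^p(ℤ^N)`. -/
def shift (p : ℝ≥0∞) [Fact (1 ≤ p)] (g : Lattice N) : Op N p :=
  LinearMap.mkContinuous
    { toFun := fun u => ⟨fun x => u (x - g), memℓp_shift g u⟩
      map_add' := fun _ _ => rfl
      map_smul' := fun _ _ => rfl }
    1 (fun u => (norm_shift_le g u).trans_eq (one_mul _).symm)

theorem shift_apply (p : ℝ≥0∞) [Fact (1 ≤ p)] (g : Lattice N) (u : Seq N p) (x : Lattice N) :
    shift p g u x = u (x - g) := rfl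

end Shift

/-- The operator `aI` of multiplication by `a ∈ l^∞(ℤ^N)` on `l^p(ℤ^N)`. -/
def mulOp {N : ℕ} (p : ℝ≥0∞) [Fact (1 ≤ p)] (a : Seq N ∞) : Op N p :=
  lp.holderL (p := ∞) (q := p) p (fun _ : Lattice N => ContinuousLinearMap.mul ℂ ℂ) (K := 1)
    (fun _ => by simp) a

theorem mulOp_apply {N : ℕ} (p : ℝ≥0∞) [Fact (1 ≤ p)] (a : Seq N ∞) (u : Seq N p)
    (x : Lattice N) : mulOp p a u x = a x * u x := rfl

/-- The difference operator `∑_α a_α V_α` on `l^p(ℤ^N)`. It is only used for coefficients with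
`∑_α ‖a_α‖_∞ < ∞`, and then the series converges absolutely in `L(l^p(ℤ^N))`; see
`diffOp_apply` for the resulting pointwise formula. -/
def diffOp {N : ℕ} (p : ℝ≥0∞) [Fact (1 ≤ p)] (a : Lattice N → Seq N ∞) : Op N p :=
  ∑' α : Lattice N, mulOp p (a α) ∘L shift p α

theorem norm_mulOp_comp_shift_le {N : ℕ} (p : ℝ≥0∞) [Fact (1 ≤ p)] (a : Seq N ∞)
    (g : Lattice N) : ‖mulOp p a ∘L shift p g‖ ≤ ‖a‖ := by
  have h1 : ‖mulOp p a‖ ≤ ‖a‖ := by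
    have := ContinuousLinearMap.le_of_opNorm_le _
      (lp.norm_holderL_le (p := ∞) (q := p) p
        (fun _ : Lattice N => ContinuousLinearMap.mul ℂ ℂ) (K := 1) (fun _ => by simp)) a
    exact this.trans_eq (by simp)
  have h2 : ‖shift p g‖ ≤ 1 := LinearMap.mkContinuous_norm_le _ zero_le_one _
  calc ‖mulOp p a ∘L shift p g‖ ≤ ‖mulOp p a‖ * ‖shift p g‖ :=
        ContinuousLinearMap.opNorm_comp_le _ _
    _ ≤ ‖a‖ * 1 := mul_le_mul h1 h2 (norm_nonneg _) (norm_nonneg _)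
    _ = ‖a‖ := mul_one _

/-- `(Au)(x) = ∑_α a_α(x) (V_α u)(x)`. -/
theorem diffOp_apply {N : ℕ} (p : ℝ≥0∞) [hp : Fact (1 ≤ p)] (a : Lattice N → Seq N ∞)
    (ha : Summable fun α => ‖a α‖) (u : Seq N p) (x : Lattice N) :
    diffOp p a u x = ∑' α : Lattice N, a α x * u (x - α) := by
  have hs : Summable fun α : Lattice N => mulOp p (a α) ∘L shift p α :=
    Summable.of_norm_bounded ha fun α => norm_mulOp_comp_shift_le p (a α) α
  have h := (lp.evalCLM ℂ (fun _ : Lattice N => ℂ) p x ∘L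
    ContinuousLinearMap.apply ℂ (Seq N p) u).hasSum hs.hasSum
  exact h.tsum_eq.symm

/-- The Wiener algebra `W(ℤ^N)`, viewed inside `L(l^p(ℤ^N))`: all operators `∑_α a_α V_α`
with `∑_α ‖a_α‖_∞ < ∞`. -/
def Wiener (N : ℕ) (p : ℝ≥0∞) [Fact (1 ≤ p)] : Set (Op N p) :=
  {A | ∃ a : Lattice N → Seq N ∞, (Summable fun α => ‖a α‖) ∧ A = diffOp p a}

/-- The sequence `h : ℕ → ℤ^N` tends to infinity, i.e. it eventually leaves every finite
(equivalently, every bounded) subset of `ℤ^N`. -/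
def TendsToInfinity {N : ℕ} (h : ℕ → Lattice N) : Prop := Tendsto h atTop cofinite

/-- A function `a ∈ l^∞(ℤ^N)` is almost-periodic if every sequence `h` tending to infinity has
a subsequence `g = h ∘ φ` such that `V_{-g(j)} a` converges in `l^∞(ℤ^N)`. -/
def IsAlmostPeriodic {N : ℕ} (a : Seq N ∞) : Prop :=
  ∀ h : ℕ → Lattice N, TendsToInfinity h →
    ∃ φ : ℕ → ℕ, StrictMono φ ∧ ∃ b : Seq N ∞,
      Tendsto (fun j => ‖shift ∞ (-h (φ j)) a - b‖) atTop (𝓝 0)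

/-- The set `W^{AP}(ℤ^N)` of all operators in the Wiener algebra with almost-periodic
coefficients, viewed inside `L(l^p(ℤ^N))`. -/
def WienerAP (N : ℕ) (p : ℝ≥0∞) [Fact (1 ≤ p)] : Set (Op N p) :=
  {A | ∃ a : Lattice N → Seq N ∞,
    (Summable fun α => ‖a α‖) ∧ (∀ α, IsAlmostPeriodic (a α)) ∧ A = diffOp p a}

/-- The shifted operator `V_{-g} A V_g`. -/
def conjShift {N : ℕ} {p : ℝ≥0∞} [Fact (1 ≤ p)] (A : Op N p) (g : Lattice N) : Op N p :=
  shift p (-g) ∘L A ∘L shift p g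

/-- The (Banach space) adjoint `A^*`, acting on the dual of `l^p(ℤ^N)` by `φ ↦ φ ∘ A`. -/
def adjointOp {N : ℕ} {p : ℝ≥0∞} [Fact (1 ≤ p)] (A : Op N p) :
    StrongDual ℂ (Seq N p) →L[ℂ] StrongDual ℂ (Seq N p) :=
  ContinuousLinearMap.precomp ℂ A

/-- `B` is the limit operator of `A` defined by the sequence `h`: the sequence `h` tends to
infinity, `V_{-h(j)} A V_{h(j)} → B` strongly and the adjoints converge strongly to `B^*`.
(Under the identification of the dual of `l^p` with `l^q`, `1/p + 1/q = 1`, the adjoint of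
`V_{-g} A V_g` is `V_{-g} A^* V_g`.) -/
def IsLimitOperator {N : ℕ} {p : ℝ≥0∞} [Fact (1 ≤ p)] (A : Op N p) (h : ℕ → Lattice N)
    (B : Op N p) : Prop :=
  TendsToInfinity h ∧
  (∀ u : Seq N p, Tendsto (fun j => conjShift A (h j) u) atTop (𝓝 (B u))) ∧
  (∀ f : StrongDual ℂ (Seq N p),
    Tendsto (fun j => adjointOp (conjShift A (h j)) f) atTop (𝓝 (adjointOp B f)))

/-- The operator spectrum `op(A)`, i.e. the set of all limit operators of `A`. -/
def operatorSpectrum {N : ℕ} {p : ℝ≥0∞} [Fact (1 ≤ p)] (A : Op N p) : Set (Op N p) :=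
  {B | ∃ h : ℕ → Lattice N, IsLimitOperator A h B}

/-- A bounded operator on a Banach space is Fredholm if its kernel and its cokernel are
finite dimensional. -/
def IsFredholmOp {X : Type*} [NormedAddCommGroup X] [NormedSpace ℂ X]
    (A : X →L[ℂ] X) : Prop :=
  FiniteDimensional ℂ A.ker ∧ FiniteDimensional ℂ (X ⧸ A.range)

/-- The essential spectrum: all `z` for which `A - zI` is not Fredholm. -/
def essSpectrum {X : Type*} [NormedAddCommGroup X] [NormedSpace ℂ X]
    (A : X →L[ℂ] X) : Set ℂ :=
  {z | ¬ IsFredholmOp (A - z • ContinuousLinearMap.id ℂ X)}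

end LimitOp

end

namespace LimitOp

section Fredholm

variable {X : Type*} [NormedAddCommGroup X] [NormedSpace ℂ X] [CompleteSpace X]

/-- An operator with finite dimensional kernel and cokernel is invertible modulo operators which
factor through finite dimensional subspaces. -/
theorem IsFredholmOp.exists_regularizer {A : X →L[ℂ] X} (hA : IsFredholmOp A) :
    ∃ (R : X →L[ℂ] X) (E F : Submodule ℂ X) (P : X →L[ℂ] E) (Q : X →L[ℂ] F),
      FiniteDimensional ℂ E ∧ FiniteDimensional ℂ F ∧
      (∀ x, R (A x) = x - P x) ∧ ∀ x, A (R x) = x - Q x := by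
  obtain ⟨hk, hc⟩ := hA
  obtain ⟨P, hP⟩ := Submodule.ClosedComplemented.of_finiteDimensional (𝕜 := ℂ) A.ker
  obtain ⟨F, hF⟩ := Submodule.exists_isCompl A.range
  have hFfin : FiniteDimensional ℂ F :=
    (Submodule.quotientEquivOfIsCompl _ _ hF).finiteDimensional
  let T : (X × F) →L[ℂ] (X × A.ker) :=
    (A ∘L ContinuousLinearMap.fst ℂ X F + F.subtypeL ∘L ContinuousLinearMap.snd ℂ X F).prod
      (P ∘L ContinuousLinearMap.fst ℂ X F)
  have hT : ∀ x f, T (x, f) = (A x + f, P x) := fun x f => rfl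
  have hAk : ∀ k : A.ker, A (k : X) = 0 := fun k => k.2
  have hker : LinearMap.ker T.toLinearMap = ⊥ := by
    rw [LinearMap.ker_eq_bot']
    rintro ⟨x, f⟩ hx
    have hx' : T (x, f) = 0 := hx
    rw [hT, Prod.mk_eq_zero] at hx'
    obtain ⟨h1, h2⟩ := hx'
    have hf : (f : X) = 0 := by
      refine Submodule.disjoint_def.1 hF.disjoint _ ?_ f.2
      rw [← neg_eq_of_add_eq_zero_right h1]
      exact neg_mem ⟨x, rfl⟩
    rw [hf, add_zero] at h1
    have hx0 : x = 0 := by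
      have := hP ⟨x, h1⟩
      simp only at this
      rw [h2] at this
      exact (congrArg Subtype.val this).symm
    simp [hx0, Subtype.ext_iff, hf]
  have hrange : LinearMap.range T.toLinearMap = ⊤ := by
    rw [LinearMap.range_eq_top]
    rintro ⟨y, k⟩
    have hy : y ∈ A.range ⊔ F := by rw [hF.sup_eq_top]; trivial
    obtain ⟨_, ⟨x, rfl⟩, f, hf, rfl⟩ := Submodule.mem_sup.1 hy
    refine ⟨(x - P x + k, ⟨f, hf⟩), ?_⟩
    change T _ = _
    rw [hT]
    ext <;> simp [hAk, hP]
  let e := ContinuousLinearEquiv.ofBijective T hker hrange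
  have he : ∀ z, T (e.symm z) = z := fun z => e.apply_symm_apply z
  have he' : ∀ z, e.symm (T z) = z := fun z => e.symm_apply_apply z
  let S : X →L[ℂ] X × F := (e.symm : (X × A.ker) →L[ℂ] X × F) ∘L
    ContinuousLinearMap.inl ℂ X A.ker
  have hS : ∀ x, S x = e.symm (x, 0) := fun x => rfl
  refine ⟨ContinuousLinearMap.fst ℂ X F ∘L S, A.ker, F, P,
    ContinuousLinearMap.snd ℂ X F ∘L S, hk, hFfin, fun x => ?_, fun x => ?_⟩
  · have : T (x - P x, 0) = (A x, 0) := by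
      rw [hT]
      ext <;> simp [hAk, hP]
    simp [hS, ← this, he']
  · have h1 := congrArg Prod.fst (he (x, 0))
    rw [← hS] at h1
    rw [eq_sub_iff_add_eq]
    exact h1

theorem isFredholmOp_of_isUnit {A : X →L[ℂ] X} (hA : IsUnit A) : IsFredholmOp A := by
  rw [ContinuousLinearMap.isUnit_iff_bijective] at hA
  have h1 : A.ker = ⊥ := LinearMap.ker_eq_bot.2 hA.1
  have h2 : A.range = ⊤ := LinearMap.range_eq_top.2 hA.2
  constructor
  · rw [h1]; infer_instance
  · rw [h2]; infer_instance

/-- An operator which is bounded below together with its adjoint is invertible. -/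
theorem isUnit_of_bounded_below {B : X →L[ℂ] X} {c : ℝ} (h1 : ∀ u, ‖u‖ ≤ c * ‖B u‖)
    (h2 : ∀ f : StrongDual ℂ X, f ∘L B = 0 → f = 0) : IsUnit B := by
  rw [ContinuousLinearMap.isUnit_iff_bijective,
    ContinuousLinearMap.bijective_iff_dense_range_and_antilipschitz]
  refine ⟨?_, c.toNNReal, ?_⟩
  · by_contra hne
    obtain ⟨x, -, hx⟩ := SetLike.exists_of_lt (lt_top_iff_ne_top.2 hne)
    set p := B.range.topologicalClosure
    have : IsClosed (p : Set X) := B.range.isClosed_topologicalClosure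
    have hx' : ‖p.mkQL x‖ ≠ 0 := by
      rw [norm_ne_zero_iff]
      exact fun h => hx ((Submodule.Quotient.mk_eq_zero p).1 h)
    obtain ⟨g, -, hg⟩ := exists_dual_vector ℂ (p.mkQL x) hx'
    have h0 : g ∘L p.mkQL = 0 := by
      refine h2 _ (ContinuousLinearMap.ext fun y => ?_)
      have : p.mkQL (B y) = 0 := (Submodule.Quotient.mk_eq_zero p).2
        (B.range.le_topologicalClosure ⟨y, rfl⟩)
      simp [this]
    have h3 : g (p.mkQL x) = 0 := DFunLike.congr_fun h0 x
    rw [h3] at hg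
    exact hx' (Complex.ofReal_eq_zero.1 hg.symm)
  · refine AddMonoidHomClass.antilipschitz_of_bound B fun x => (h1 x).trans ?_
    gcongr
    exact Real.le_coe_toNNReal c

end Fredholm

/-- An operator factoring through a finite dimensional subspace is a finite sum of operators of
rank one. -/
theorem exists_sum_rank_one {X : Type*} [NormedAddCommGroup X] [NormedSpace ℂ X]
    (E : Submodule ℂ X) [FiniteDimensional ℂ E] (P : X →L[ℂ] E) :
    ∃ (n : ℕ) (φ : Fin n → StrongDual ℂ X) (v : Fin n → X),
      ∀ x, (P x : X) = ∑ i, φ i x • v i := by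
  let b := Module.finBasis ℂ E
  refine ⟨_, fun i => (LinearMap.toContinuousLinearMap (b.coord i)) ∘L P, fun i => b i,
    fun x => ?_⟩
  conv_lhs => rw [← b.sum_repr (P x)]
  rw [Submodule.coe_sum]
  rfl

end LimitOp

namespace LimitOp

variable {N : ℕ} {p : ℝ≥0∞} [Fact (1 ≤ p)]

section ShiftGroup

theorem shift_shift (g g' : Lattice N) (u : Seq N p) :
    shift p g (shift p g' u) = shift p (g + g') u := by
  ext x
  simp only [shift_apply, sub_sub]

theorem shift_zero : shift p (0 : Lattice N) = 1 := by
  ext u x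
  simp [shift_apply]

theorem shift_mul_shift_neg (g : Lattice N) : shift p g * shift p (-g) = 1 := by
  ext1 u
  simp [shift_shift, shift_zero]

theorem shift_neg_mul_shift (g : Lattice N) : shift p (-g) * shift p g = 1 := by
  ext1 u
  simp [shift_shift, shift_zero]

theorem norm_shift (g : Lattice N) (u : Seq N p) : ‖shift p g u‖ = ‖u‖ := by
  refine le_antisymm (norm_shift_le g u) ?_
  calc ‖u‖ = ‖shift p (-g) (shift p g u)‖ := by simp [shift_shift, shift_zero]
    _ ≤ ‖shift p g u‖ := norm_shift_le _ _

theorem opNorm_shift_le (g : Lattice N) : ‖shift p g‖ ≤ 1 :=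
  ContinuousLinearMap.opNorm_le_bound _ zero_le_one fun u => by rw [norm_shift, one_mul]

theorem conjShift_eq_mul (A : Op N p) (g : Lattice N) :
    conjShift A g = shift p (-g) * A * shift p g := rfl

theorem conjShift_sub (A B : Op N p) (g : Lattice N) :
    conjShift (A - B) g = conjShift A g - conjShift B g := by
  simp only [conjShift_eq_mul, mul_sub, sub_mul]

theorem conjShift_mul (A B : Op N p) (g : Lattice N) :
    conjShift (A * B) g = conjShift A g * conjShift B g := by
  simp only [conjShift_eq_mul]
  calc _ = shift p (-g) * A * 1 * B * shift p g := by simp only [mul_assoc, one_mul]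
    _ = _ := by rw [← shift_mul_shift_neg g]; simp only [mul_assoc]

theorem conjShift_algebraMap (z : ℂ) (g : Lattice N) :
    conjShift (algebraMap ℂ (Op N p) z) g = algebraMap ℂ (Op N p) z := by
  rw [conjShift_eq_mul, ← Algebra.commutes, mul_assoc, shift_neg_mul_shift, mul_one]

theorem isUnit_conjShift_iff (A : Op N p) (g : Lattice N) :
    IsUnit (conjShift A g) ↔ IsUnit A := by
  let s : (Op N p)ˣ := ⟨shift p g, shift p (-g), shift_mul_shift_neg g, shift_neg_mul_shift g⟩
  have : conjShift A g = ↑s⁻¹ * A * ↑s := rfl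
  rw [this, Units.isUnit_mul_units, Units.isUnit_units_mul]

theorem norm_conjShift_le (A : Op N p) (g : Lattice N) : ‖conjShift A g‖ ≤ ‖A‖ := by
  rw [conjShift_eq_mul]
  calc _ ≤ ‖shift p (-g)‖ * ‖A‖ * ‖shift p g‖ :=
        (norm_mul_le _ _).trans (by gcongr; exact norm_mul_le _ _)
    _ ≤ 1 * ‖A‖ * 1 := by gcongr <;> exact opNorm_shift_le _
    _ = ‖A‖ := by ring

theorem shift_single (g x : Lattice N) (c : ℂ) :
    shift p g (lp.single p x c) = lp.single p (x + g) c := by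
  ext y
  simp only [shift_apply, lp.single_apply, Pi.single_apply, sub_eq_iff_eq_add]

end ShiftGroup

section WeakConvergence

/-- A functional on `l^p` with `1 < p < ∞` exceeds `ε` only on finitely many unit vectors. -/
theorem tendsto_dual_single (hp1 : 1 < p) (hp2 : p < ⊤) (φ : StrongDual ℂ (Seq N p)) :
    Tendsto (fun x : Lattice N => φ (lp.single p x 1)) cofinite (𝓝 0) := by
  rw [tendsto_zero_iff_norm_tendsto_zero]
  have hp : 1 < p.toReal := by
    rw [← ENNReal.toReal_one]
    exact (ENNReal.toReal_lt_toReal ENNReal.one_ne_top hp2.ne).2 hp1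
  have hp0 : 0 < p.toReal := zero_lt_one.trans hp
  -- testing against sums of unit vectors with the right phases
  have key : ∀ s : Finset (Lattice N),
      ∑ x ∈ s, ‖φ (lp.single p x 1)‖ ≤ ‖φ‖ * (s.card : ℝ) ^ (1 / p.toReal) := by
    intro s
    have hc : ∀ x : Lattice N, ∃ c : ℂ, ‖c‖ = 1 ∧
        c * φ (lp.single p x 1) = (‖φ (lp.single p x 1)‖ : ℂ) := by
      intro x
      exact RCLike.exists_norm_eq_mul_self (φ (lp.single p x 1)) |>.imp
        fun c h => ⟨h.1, h.2.symm⟩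
    choose c hc1 hc2 using hc
    have h1 : φ (∑ x ∈ s, lp.single p x (c x)) = ((∑ x ∈ s, ‖φ (lp.single p x 1)‖ : ℝ) : ℂ) := by
      rw [map_sum, Complex.ofReal_sum]
      refine Finset.sum_congr rfl fun x _ => ?_
      rw [← hc2, ← smul_eq_mul, ← map_smul, ← lp.single_smul, smul_eq_mul, mul_one]
    have h2 : ‖∑ x ∈ s, (lp.single p x (c x) : Seq N p)‖ = (s.card : ℝ) ^ (1 / p.toReal) := by
      have := lp.norm_sum_single (E := fun _ : Lattice N => ℂ) hp0 c s
      simp only [hc1, Real.one_rpow, Finset.sum_const, nsmul_eq_mul, mul_one] at this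
      rw [← this, one_div, Real.rpow_rpow_inv (norm_nonneg _) hp0.ne']
    have h3 := φ.le_opNorm (∑ x ∈ s, lp.single p x (c x))
    rw [h1, h2, Complex.norm_real] at h3
    exact (le_abs_self _).trans h3
  rw [Metric.tendsto_nhds]
  intro ε hε
  rw [eventually_cofinite]
  by_contra hinf
  have hlim : Tendsto (fun n : ℕ => ε * (n : ℝ) ^ (1 - 1 / p.toReal)) atTop atTop := by
    refine Tendsto.const_mul_atTop hε
      ((tendsto_rpow_atTop ?_).comp tendsto_natCast_atTop_atTop)
    rw [sub_pos, div_lt_one hp0]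
    exact hp
  obtain ⟨n, hn, hn0⟩ :=
    ((hlim.eventually_gt_atTop ‖φ‖).and (eventually_gt_atTop 0)).exists
  obtain ⟨s, hs, rfl⟩ := Set.Infinite.exists_subset_card_eq hinf n
  have hcard : (0 : ℝ) < s.card := by exact_mod_cast hn0
  have h4 : (s.card : ℝ) * ε ≤ ∑ x ∈ s, ‖φ (lp.single p x 1)‖ := by
    rw [← nsmul_eq_mul]
    refine Finset.card_nsmul_le_sum s _ _ fun x hx => ?_
    have := hs hx
    simpa using this
  have h6 : (s.card : ℝ) ^ (1 - 1 / p.toReal) * (s.card : ℝ) ^ (1 / p.toReal) =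
      s.card := by
    rw [← Real.rpow_add hcard, sub_add_cancel, Real.rpow_one]
  have h7 : 0 < (s.card : ℝ) ^ (1 / p.toReal) := Real.rpow_pos_of_pos hcard _
  rw [mul_comm, ← h6, ← mul_assoc] at h4
  have h5 := h4.trans (key s)
  exact absurd (le_of_mul_le_mul_right h5 h7) (not_le.2 hn)

/-- For `1 < p < ∞`, the translates `V_g u` converge weakly to zero as `g` tends to infinity. -/
theorem tendsto_dual_shift (hp1 : 1 < p) (hp2 : p < ⊤) (φ : StrongDual ℂ (Seq N p))
    (u : Seq N p) : Tendsto (fun g : Lattice N => φ (shift p g u)) cofinite (𝓝 0) := by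
  have hbase : ∀ (x : Lattice N) (c : ℂ),
      Tendsto (fun g : Lattice N => φ (shift p g (lp.single p x c))) cofinite (𝓝 0) := by
    intro x c
    have h := ((tendsto_dual_single hp1 hp2 φ).comp
      (add_right_injective x).tendsto_cofinite).const_mul c
    rw [mul_zero] at h
    refine h.congr fun g => ?_
    rw [Function.comp_apply, shift_single, ← smul_eq_mul, ← map_smul, ← lp.single_smul,
      smul_eq_mul, mul_one]
  rw [Metric.tendsto_nhds]
  intro ε hε
  have hsum := lp.hasSum_single hp2.ne u
  have hφ : 0 < ‖φ‖ + 1 := by positivity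
  obtain ⟨s, hs⟩ := (Metric.tendsto_nhds.1 hsum (ε / 2 / (‖φ‖ + 1)) (by positivity)).exists
  have hfin : Tendsto (fun g : Lattice N =>
      φ (shift p g (∑ x ∈ s, lp.single p x (u x)))) cofinite (𝓝 0) := by
    simp only [map_sum]
    simpa using tendsto_finsetSum s fun x _ => hbase x (u x)
  filter_upwards [Metric.tendsto_nhds.1 hfin (ε / 2) (by positivity)] with g hg
  rw [dist_eq_norm] at hs
  rw [dist_zero_right] at hg ⊢
  set w := ∑ x ∈ s, lp.single p x (u x)
  have h1 : ‖φ (shift p g (w - u))‖ ≤ ε / 2 := by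
    calc _ ≤ ‖φ‖ * ‖w - u‖ := by rw [← norm_shift g (w - u)]; exact φ.le_opNorm _
      _ ≤ (‖φ‖ + 1) * (ε / 2 / (‖φ‖ + 1)) := by gcongr; linarith
      _ = ε / 2 := by field_simp
  rw [map_sub, map_sub] at h1
  calc _ = ‖φ (shift p g w) - (φ (shift p g w) - φ (shift p g u))‖ := by congr 1; ring
    _ ≤ _ := norm_sub_le _ _
    _ < ε := by linarith

end WeakConvergence

section Limits

variable {l : Filter (Lattice N)}

/-- If the shifts of a Fredholm operator converge in norm at infinity, the limit is invertible. -/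
theorem isUnit_of_tendsto_conjShift [l.NeBot] (hl : l ≤ cofinite) (hp1 : 1 < p) (hp2 : p < ⊤)
    {A B : Op N p} (hA : IsFredholmOp A) (hAB : Tendsto (conjShift A) l (𝓝 B)) : IsUnit B := by
  obtain ⟨R, E, F, P, Q, hE, hF, hP, hQ⟩ := hA.exists_regularizer
  have hneg : Tendsto (fun g : Lattice N => -g) l cofinite :=
    neg_injective.tendsto_cofinite.mono_left hl
  refine isUnit_of_bounded_below (c := ‖R‖) (fun u => ?_) fun f hf => ?_
  · obtain ⟨n, φ, v, hφ⟩ := exists_sum_rank_one E P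
    have hK : Tendsto (fun g => ‖(P (shift p g u) : Seq N p)‖) l (𝓝 0) := by
      have : Tendsto (fun g => ∑ i, ‖φ i (shift p g u)‖ * ‖v i‖) l (𝓝 0) := by
        simpa using tendsto_finsetSum Finset.univ fun i _ =>
          (((tendsto_dual_shift hp1 hp2 (φ i) u).mono_left hl).norm.mul_const ‖v i‖)
      refine squeeze_zero (fun _ => norm_nonneg _) (fun g => ?_) this
      rw [hφ]
      exact (norm_sum_le _ _).trans_eq (by simp only [norm_smul])
    have hAu : Tendsto (fun g => ‖R‖ * ‖conjShift A g u‖ + ‖(P (shift p g u) : Seq N p)‖) l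
        (𝓝 (‖R‖ * ‖B u‖ + 0)) :=
      (((ContinuousLinearMap.apply ℂ (Seq N p) u).continuous.tendsto B).comp hAB).norm.const_mul
        ‖R‖ |>.add hK
    rw [add_zero] at hAu
    refine ge_of_tendsto' hAu fun g => ?_
    have h1 : ‖conjShift A g u‖ = ‖A (shift p g u)‖ := norm_shift _ _
    rw [h1, ← norm_shift g u]
    calc ‖shift p g u‖ = ‖R (A (shift p g u)) + P (shift p g u)‖ := by rw [hP, sub_add_cancel]
      _ ≤ _ := (norm_add_le _ _).trans (by gcongr; exact R.le_opNorm _)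
  · obtain ⟨n, φ, v, hφ⟩ := exists_sum_rank_one F Q
    have hlim : Tendsto (fun g => ‖f ∘L conjShift A g‖ * ‖R‖ +
        ∑ i, ‖f (shift p (-g) (v i))‖ * ‖φ i‖) l (𝓝 0) := by
      have h1 : Tendsto (fun g => ‖f ∘L conjShift A g‖ * ‖R‖) l (𝓝 0) := by
        have := ((((ContinuousLinearMap.compL ℂ _ _ _ f).continuous.tendsto B).comp
          hAB).norm.mul_const ‖R‖)
        simpa [hf] using this
      have h2 : Tendsto (fun g => ∑ i, ‖f (shift p (-g) (v i))‖ * ‖φ i‖) l (𝓝 0) := by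
        simpa using tendsto_finsetSum Finset.univ fun i _ =>
          (((tendsto_dual_shift hp1 hp2 f (v i)).comp hneg).norm.mul_const ‖φ i‖)
      simpa using h1.add h2
    rw [← norm_le_zero_iff]
    refine ge_of_tendsto' hlim fun g => ?_
    refine f.opNorm_le_bound (by positivity) fun u => ?_
    have h3 : shift p g (shift p (-g) (A (R (shift p g u)))) = A (R (shift p g u)) := by
      simp [shift_shift, shift_zero]
    have h4 : u = conjShift A g (conjShift R g u) + ∑ i, φ i (shift p g u) • shift p (-g) (v i) := by
      have h5 : conjShift A g (conjShift R g u) = shift p (-g) (A (R (shift p g u))) := by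
        change (conjShift A g * conjShift R g) u = _
        rw [← conjShift_mul]
        rfl
      rw [h5, hQ, hφ, map_sub, map_sum]
      simp [shift_shift, shift_zero]
    conv_lhs => rw [h4]
    rw [map_add, map_sum, add_mul, Finset.sum_mul]
    refine (norm_add_le _ _).trans (add_le_add ?_ ((norm_sum_le _ _).trans
      (Finset.sum_le_sum fun i _ => ?_)))
    · calc _ ≤ ‖f ∘L conjShift A g‖ * ‖conjShift R g u‖ := (f ∘L conjShift A g).le_opNorm _
        _ ≤ ‖f ∘L conjShift A g‖ * (‖R‖ * ‖u‖) := by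
          gcongr
          exact ContinuousLinearMap.le_of_opNorm_le _ (norm_conjShift_le R g) u
        _ = _ := by ring
    · rw [map_smul, norm_smul, mul_comm, mul_assoc]
      gcongr
      rw [← norm_shift g u]
      exact (φ i).le_opNorm _

theorem isUnit_of_tendsto_conjShift_of_isUnit [l.NeBot] {A B : Op N p}
    (hAB : Tendsto (conjShift A) l (𝓝 B)) (hB : IsUnit B) : IsUnit A := by
  obtain ⟨g, hg⟩ := (hAB.eventually (Units.isOpen.mem_nhds hB)).exists
  exact (isUnit_conjShift_iff A g).1 hg

theorem tendsto_conjShift_algebraMap_sub {A B : Op N p} (hAB : Tendsto (conjShift A) l (𝓝 B))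
    (z : ℂ) : Tendsto (conjShift (algebraMap ℂ (Op N p) z - A)) l
      (𝓝 (algebraMap ℂ (Op N p) z - B)) := by
  refine (hAB.const_sub _).congr fun g => ?_
  rw [conjShift_sub, conjShift_algebraMap]

theorem essSpectrum_subset_spectrum (A : Op N p) : essSpectrum A ⊆ spectrum ℂ A := by
  intro z hz hu
  have : A - z • ContinuousLinearMap.id ℂ (Seq N p) = -(algebraMap ℂ (Op N p) z - A) := by
    rw [neg_sub, Algebra.algebraMap_eq_smul_one]; rfl
  refine hz ?_
  rw [this]
  exact isFredholmOp_of_isUnit (IsUnit.neg hu)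

theorem essSpectrum_eq_spectrum_of_tendsto_conjShift [l.NeBot] (hl : l ≤ cofinite) (hp1 : 1 < p)
    (hp2 : p < ⊤) {A B : Op N p} (hAB : Tendsto (conjShift A) l (𝓝 B)) :
    essSpectrum A = spectrum ℂ A := by
  refine (essSpectrum_subset_spectrum A).antisymm fun z hz hF => hz ?_
  have heq : A - z • ContinuousLinearMap.id ℂ (Seq N p) = -(algebraMap ℂ (Op N p) z - A) := by
    rw [neg_sub, Algebra.algebraMap_eq_smul_one]; rfl
  have hlim := tendsto_conjShift_algebraMap_sub hAB z
  have hlim' : Tendsto (conjShift (A - z • ContinuousLinearMap.id ℂ (Seq N p))) l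
      (𝓝 (-(algebraMap ℂ (Op N p) z - B))) := by
    refine hlim.neg.congr fun g => ?_
    rw [heq, conjShift_eq_mul, conjShift_eq_mul, mul_neg, neg_mul]
  have hB := isUnit_of_tendsto_conjShift hl hp1 hp2 hF hlim'
  exact isUnit_of_tendsto_conjShift_of_isUnit hlim (IsUnit.neg_iff _ |>.1 hB)

theorem spectrum_eq_of_tendsto_conjShift [l.NeBot] {A B : Op N p}
    (hAB : Tendsto (conjShift A) l (𝓝 B)) : spectrum ℂ A = spectrum ℂ B := by
  ext z
  have hlim := tendsto_conjShift_algebraMap_sub hAB z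
  refine not_congr ⟨fun hA => ?_, isUnit_of_tendsto_conjShift_of_isUnit hlim⟩
  obtain ⟨T, hT⟩ := hA
  have hmul : (↑T⁻¹ : Op N p) * (algebraMap ℂ (Op N p) z - A) = 1 := by rw [← hT]; simp
  have hone : conjShift (1 : Op N p) = fun _ : Lattice N => 1 := by
    ext1 g
    simpa using conjShift_algebraMap (p := p) 1 g
  have h1 : Tendsto (fun g => conjShift (↑T⁻¹ : Op N p) g * (algebraMap ℂ (Op N p) z - B)) l
      (𝓝 1) := by
    rw [tendsto_iff_norm_sub_tendsto_zero] at hlim ⊢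
    have h2 := hlim.const_mul ‖(↑T⁻¹ : Op N p)‖
    rw [mul_zero] at h2
    refine squeeze_zero (fun _ => norm_nonneg _) (fun g => ?_) h2
    have h3 : (1 : Op N p) = conjShift (↑T⁻¹ : Op N p) g *
        conjShift (algebraMap ℂ (Op N p) z - A) g := by
      rw [← conjShift_mul, hmul, hone]
    rw [norm_sub_rev]
    conv_lhs => rw [h3, ← mul_sub]
    refine (norm_mul_le _ _).trans ?_
    gcongr
    exact norm_conjShift_le _ _
  obtain ⟨g, hg⟩ := (h1.eventually (Units.isOpen.mem_nhds isUnit_one)).exists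
  obtain ⟨S, hS⟩ := (isUnit_conjShift_iff (↑T⁻¹ : Op N p) g).2 T⁻¹.isUnit
  rw [← hS] at hg
  exact (Units.isUnit_units_mul S _).1 hg

end Limits

end LimitOp

namespace LimitOp

variable {N : ℕ} {p : ℝ≥0∞} [Fact (1 ≤ p)]

section AlmostPeriodic

theorem conjShift_mulOp_comp_shift (a : Seq N ∞) (α g : Lattice N) :
    conjShift (mulOp p a ∘L shift p α) g = mulOp p (shift ∞ (-g) a) ∘L shift p α := by
  ext u x
  change mulOp p a (shift p α (shift p g u)) (x - -g) =
    mulOp p (shift ∞ (-g) a) (shift p α u) x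
  have hx : x - -g - α - g = x - α := by rw [sub_neg_eq_add, sub_right_comm, add_sub_cancel_right]
  simp only [mulOp_apply, shift_apply, hx]

theorem summable_mulOp_comp_shift {a : Lattice N → Seq N ∞} (ha : Summable fun α => ‖a α‖) :
    Summable fun α : Lattice N => mulOp p (a α) ∘L shift p α :=
  Summable.of_norm_bounded ha fun α => norm_mulOp_comp_shift_le p (a α) α

theorem conjShift_diffOp {a : Lattice N → Seq N ∞} (ha : Summable fun α => ‖a α‖)
    (g : Lattice N) : conjShift (diffOp p a) g = diffOp p fun α => shift ∞ (-g) (a α) := by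
  have hs := summable_mulOp_comp_shift (p := p) ha
  rw [conjShift_eq_mul, diffOp, ← hs.tsum_mul_left, ← (hs.mul_left _).tsum_mul_right]
  exact tsum_congr fun α => conjShift_mulOp_comp_shift (a α) α g

/-- The translates of an almost-periodic function form a totally bounded set. -/
theorem IsAlmostPeriodic.totallyBounded {a : Seq N ∞} (ha : IsAlmostPeriodic a) :
    TotallyBounded (Set.range fun g : Lattice N => shift ∞ (-g) a) := by
  rw [Metric.totallyBounded_iff]
  by_contra! hcon
  obtain ⟨ε, hε, hcon⟩ := hcon
  obtain ⟨h, -, hh⟩ := exists_seq_of_forall_finset_exists (α := Lattice N) (fun _ => True)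
    (fun x y => ε ≤ dist (shift ∞ (-y) a) (shift ∞ (-x) a)) (fun s _ => by
      obtain ⟨_, ⟨y, rfl⟩, hy⟩ := Set.not_subset.1
        (hcon ((fun g : Lattice N => shift ∞ (-g) a) '' s) (s.finite_toSet.image _))
      refine ⟨y, trivial, fun x hx => ?_⟩
      by_contra! hlt
      exact hy (Set.mem_biUnion (Set.mem_image_of_mem _ hx) hlt))
  have hinj : Function.Injective h := by
    refine Function.Injective.of_lt_imp_ne fun m n hmn heq => ?_
    have := hh m n hmn
    rw [heq, dist_self] at this
    exact absurd this (not_le.2 hε)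
  obtain ⟨φ, hφ, b, hb⟩ := ha h (by
    rw [TendsToInfinity, ← Nat.cofinite_eq_atTop]; exact hinj.tendsto_cofinite)
  have hb' := tendsto_iff_norm_sub_tendsto_zero.2 hb
  obtain ⟨n, hn⟩ := Metric.cauchySeq_iff.1 hb'.cauchySeq ε hε
  exact absurd (hn (n + 1) (Nat.le_succ n) n le_rfl) (not_lt.2 (hh _ _ (hφ (Nat.lt_succ_self n))))

theorem IsAlmostPeriodic.exists_tendsto_ultrafilter {a : Seq N ∞} (ha : IsAlmostPeriodic a)
    (U : Ultrafilter (Lattice N)) : ∃ b, Tendsto (fun g => shift ∞ (-g) a) U (𝓝 b) :=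
  cauchy_map_iff_exists_tendsto.1 <|
    totallyBounded_iff_ultrafilter.1 ha.totallyBounded (U.map fun g => shift ∞ (-g) a)
      (le_principal_iff.2 (Filter.range_mem_map))

/-- The shifts of an operator in the Wiener algebra with almost-periodic coefficients converge in
norm along every ultrafilter. -/
theorem exists_tendsto_conjShift_of_mem_wienerAP {A : Op N p} (hA : A ∈ WienerAP N p)
    (U : Ultrafilter (Lattice N)) : ∃ B, Tendsto (conjShift A) U (𝓝 B) := by
  obtain ⟨a, ha, hap, rfl⟩ := hA
  choose b hb using fun α => (hap α).exists_tendsto_ultrafilter U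
  refine ⟨diffOp p b, ?_⟩
  have hcont : ∀ α : Lattice N, Continuous fun c : Seq N ∞ => mulOp p c ∘L shift p α := fun α =>
    (ContinuousLinearMap.precomp (Seq N p) (shift p α)).continuous.comp
      (lp.holderL (p := ∞) (q := p) p (fun _ : Lattice N => ContinuousLinearMap.mul ℂ ℂ) (K := 1)
        (fun _ => by simp)).continuous
  refine (tendsto_tsum_of_dominated_convergence (𝓕 := (U : Filter (Lattice N)))
    (f := fun g α => mulOp p (shift ∞ (-g) (a α)) ∘L shift p α)
    (g := fun α => mulOp p (b α) ∘L shift p α) ha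
    (fun α => ((hcont α).tendsto (b α)).comp (hb α))
    (Eventually.of_forall fun g α => ?_)).congr fun g => (conjShift_diffOp ha g).symm
  exact (norm_mulOp_comp_shift_le p _ α).trans_eq (norm_shift _ _)

theorem tendsto_conjShift_of_isLimitOperator {A B : Op N p} (hA : A ∈ WienerAP N p)
    {h : ℕ → Lattice N} (hB : IsLimitOperator A h B) :
    ∃ U : Ultrafilter (Lattice N), Tendsto (conjShift A) U (𝓝 B) := by
  let U := (hyperfilter ℕ).map h
  obtain ⟨C, hC⟩ := exists_tendsto_conjShift_of_mem_wienerAP hA U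
  have hCB : C = B := by
    refine ContinuousLinearMap.ext fun u => ?_
    have h1 : Tendsto (fun j => conjShift A (h j) u) (hyperfilter ℕ) (𝓝 (C u)) :=
      ((ContinuousLinearMap.apply ℂ (Seq N p) u).continuous.tendsto C).comp hC
    exact tendsto_nhds_unique h1 ((hB.2.1 u).mono_left Nat.hyperfilter_le_atTop)
  exact ⟨U, hCB ▸ hC⟩

end AlmostPeriodic

end LimitOp

theorem proposition2p5 (N : ℕ) (hN : 0 < N) (p : ENNReal) [Fact (1 ≤ p)]
    (hp1 : 1 < p) (hp2 : p < ⊤) :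
    (∀ A ∈ LimitOp.Wiener N p,
      (∃ h : ℕ → LimitOp.Lattice N, LimitOp.TendsToInfinity h ∧ ∃ B : LimitOp.Op N p,
        Tendsto (fun j => ‖LimitOp.conjShift A (h j) - B‖) atTop (𝓝 0)) →
      LimitOp.essSpectrum A = spectrum ℂ A) ∧
    (∀ A ∈ LimitOp.WienerAP N p,
      spectrum ℂ A = LimitOp.essSpectrum A ∧
      ∀ B ∈ LimitOp.operatorSpectrum A, spectrum ℂ A = spectrum ℂ B) := by
  refine ⟨?_, fun A hA => ⟨?_, ?_⟩⟩
  · rintro A - ⟨h, hh, B, hB⟩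
    have hlim : Tendsto (LimitOp.conjShift A) (map h atTop) (𝓝 B) :=
      tendsto_map'_iff.2 (tendsto_iff_norm_sub_tendsto_zero.2 hB)
    exact LimitOp.essSpectrum_eq_spectrum_of_tendsto_conjShift hh hp1 hp2 hlim
  · have : Nonempty (Fin N) := ⟨⟨0, hN⟩⟩
    obtain ⟨B, hB⟩ := LimitOp.exists_tendsto_conjShift_of_mem_wienerAP hA
      (hyperfilter (LimitOp.Lattice N))
    exact (LimitOp.essSpectrum_eq_spectrum_of_tendsto_conjShift hyperfilter_le_cofinite
      hp1 hp2 hB).symm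
  · rintro B ⟨h, hh⟩
    obtain ⟨U, hU⟩ := LimitOp.tendsto_conjShift_of_isLimitOperator hA hh
    exact LimitOp.spectrum_eq_of_tendsto_conjShift hU
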